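/- Let $n\ge 2$, let $C=[-1,1]^n\subset\mathbb{R}^n$, let $|\cdot|$ be the Euclidean norm and $\|\cdot\|$ the maximum norm on $\mathbb{R}^n$. Let $IC$ be the intersection body of $C$, i.e. the $\mathbf{o}$-symmetric star body whose distance function $f(\mathbf{x})=\inf\{\lambda>0:\mathbf{x}\in\lambda\, IC\}$ is $$f(\mathbf{x})=\frac{|\mathbf{x}|}{\mathrm{vol}_{n-1}(\mathbf{x}^\perp\cap C)}\qquad(\mathbf{x}\neq \mathbf{o}),$$ where $\mathbf{x}^\perp$ is the $(n-1)$-dimensional linear subspace orthogonal to $\mathbf{x}$. Let $\mathbf{v}=(1,\ldots,1)$ and $$\sigma_n=\frac{2}{\pi}\int_0^\infty\left(\frac{\sin t}{t}\right)^n dt.$$ Then for every non-zero $\mathbf{x}\in\mathbb{R}^n$ $$f\left(\frac{\mathbf{x}}{\|\mathbf{x}\|}\right)\le f(\mathbf{v})=\frac{1}{\sigma_n 2^{n-1}},$$ and equality $f(\mathbf{x}/\|\mathbf{x}\|)=f(\mathbf{v})$ holds only if $n=2$ or $\mathbf{x}/\|\mathbf{x}\|$ is a vertex of the cube $C$. 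-/

import Mathlib

open MeasureTheory Set

noncomputable section

/-- The `(n-1)`-dimensional volume (normalised as Lebesgue measure on Euclidean spaces) of the
section `x^⊥ ∩ L`, where `x^⊥` is the linear subspace orthogonal to `x`. -/
def sectionVolume {n : ℕ} (L : Set (EuclideanSpace ℝ (Fin n))) (x : EuclideanSpace ℝ (Fin n)) :
    ENNReal :=
  Measure.euclideanHausdorffMeasure (n - 1)
    (((Submodule.span ℝ {x})ᗮ : Set (EuclideanSpace ℝ (Fin n))) ∩ L)

/-- The intersection body `IL` of `L`: the set whose distance function is
`x ↦ |x| / vol_{n-1}(x^⊥ ∩ L)`, i.e. the set of all `x` with `|x| ≤ vol_{n-1}(x^⊥ ∩ L)`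
(see `distanceFunction_intersectionBody`). -/
def intersectionBody {n : ℕ} (L : Set (EuclideanSpace ℝ (Fin n))) :
    Set (EuclideanSpace ℝ (Fin n)) :=
  {x | ENNReal.ofReal ‖x‖ ≤ sectionVolume L x}

/-- The distance function `f_K(x) = inf {r > 0 : x ∈ r K}` of a star body `K`. -/
def distanceFunction {n : ℕ} (K : Set (EuclideanSpace ℝ (Fin n)))
    (x : EuclideanSpace ℝ (Fin n)) : ℝ :=
  gauge K x

theorem sectionVolume_smul {n : ℕ} (L : Set (EuclideanSpace ℝ (Fin n)))
    (x : EuclideanSpace ℝ (Fin n)) {r : ℝ} (hr : r ≠ 0) :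
    sectionVolume L (r • x) = sectionVolume L x := by
  unfold sectionVolume
  rw [Submodule.span_singleton_smul_eq (IsUnit.mk0 r hr)]

/-- The distance function of the intersection body is `|x| / vol_{n-1}(x^⊥ ∩ L)`. -/
theorem distanceFunction_intersectionBody {n : ℕ} (L : Set (EuclideanSpace ℝ (Fin n)))
    (x : EuclideanSpace ℝ (Fin n)) (h0 : sectionVolume L x ≠ 0) (h1 : sectionVolume L x ≠ ⊤) :
    distanceFunction (intersectionBody L) x = ‖x‖ / (sectionVolume L x).toReal := by
  have hpos : 0 < (sectionVolume L x).toReal := ENNReal.toReal_pos h0 h1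
  have key : ∀ r : ℝ, 0 < r →
      (r⁻¹ • x ∈ intersectionBody L ↔ ‖x‖ / (sectionVolume L x).toReal ≤ r) := by
    intro r hr
    unfold intersectionBody
    change ENNReal.ofReal ‖r⁻¹ • x‖ ≤ sectionVolume L (r⁻¹ • x) ↔ _
    rw [sectionVolume_smul L x (inv_ne_zero hr.ne'),
      ENNReal.ofReal_le_iff_le_toReal h1, norm_smul, Real.norm_eq_abs,
      abs_of_pos (inv_pos.mpr hr), div_le_iff₀ hpos, inv_mul_le_iff₀ hr]
  have hset : {r : ℝ | 0 < r ∧ r⁻¹ • x ∈ intersectionBody L}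
      = {r : ℝ | 0 < r ∧ ‖x‖ / (sectionVolume L x).toReal ≤ r} := by
    ext r
    exact and_congr_right (fun hr => key r hr)
  have hnn : 0 ≤ ‖x‖ / (sectionVolume L x).toReal := by positivity
  unfold distanceFunction
  rw [gauge_def']
  show sInf {r : ℝ | 0 < r ∧ r⁻¹ • x ∈ intersectionBody L} = _
  rw [hset]
  apply le_antisymm
  · refine le_of_forall_pos_le_add (fun ε hε => ?_)
    exact csInf_le ⟨0, fun r hr => hr.1.le⟩ ⟨by positivity, by linarith⟩
  · exact le_csInf ⟨‖x‖ / (sectionVolume L x).toReal + 1, by positivity, by linarith⟩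
      (fun r hr => hr.2)

/-- The cube `C = [-1,1]^n`. -/
def cube (n : ℕ) : Set (EuclideanSpace ℝ (Fin n)) :=
  {x | ∀ i, x i ∈ Icc (-1 : ℝ) 1}

/-- The maximum norm of a vector: the norm of `Fin n → ℝ` in Mathlib is the maximum norm. -/
def maxNorm {n : ℕ} (x : EuclideanSpace ℝ (Fin n)) : ℝ :=
  ‖(WithLp.ofLp x : Fin n → ℝ)‖

/-- The vector `(1, …, 1)`. -/
def onesVector (n : ℕ) : EuclideanSpace ℝ (Fin n) :=
  WithLp.toLp 2 (fun _ => (1 : ℝ))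

/-- The sinc integral `σ_n = (2/π) ∫_0^∞ (sin t / t)^n dt`, absolutely convergent for `n ≥ 2`. -/
def sigma (n : ℕ) : ℝ :=
  (2 / Real.pi) * ∫ t in Ioi (0 : ℝ), (Real.sin t / t) ^ n

end

/-! Normalise `x` so that some `|x j| = 1`. Solving `⟨x, z⟩ = 0` for `z j` makes the section `x^⊥ ∩
C` a graph over the remaining coordinates. The constraint `|z j| ≤ 1` turns into a slab condition,
and the graph map scales volume by `|x|`. The factor `|x|` cancels, so `f(x)` is the reciprocal of a
slab volume (`distanceFunction_intersectionBody_cube`).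

By Fubini, `slabVolume a s` averages a lower-dimensional slab volume over a window centred at `s`.
Such averages preserve evenness and unimodality, so the volume at `s = 0` can only drop when some
`|a i|` grows (`slabVolume_anti`). With all `|a i| ≤ 1`, the minimum is at `a = 1`, which gives the
inequality. For `n ≥ 3`, strict decrease of `slabVolume 1` near the origin makes the minimum strict
(`slabVolume_one_lt_update`). For `n = 2` the slab is all of `[-1,1]`.

Finally, `slabVolume 1` on `m` coordinates is the convolution of `m + 1` copies of the indicator of
`[-1,1]`; Fourier inversion at `0` yields the sinc integral (`slabVolume_one_eq_sigma`). -/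

/-! ### Slab volumes and Fubini -/

/-- The points `y` of the cube `[-1,1]^m` with `|s + ∑ aᵢ yᵢ| ≤ 1`. -/
def slabSet {m : ℕ} (a : Fin m → ℝ) (s : ℝ) : Set (Fin m → ℝ) :=
  {y | (∀ i, y i ∈ Icc (-1 : ℝ) 1) ∧ |s + ∑ i, a i * y i| ≤ 1}

/-- The volume of `slabSet a s`. -/
noncomputable def slabVolume {m : ℕ} (a : Fin m → ℝ) (s : ℝ) : ℝ :=
  (volume (slabSet a s)).toReal

theorem measurableSet_slabSet_prod {m : ℕ} (a : Fin m → ℝ) (c d : ℝ) :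
    MeasurableSet {p : ℝ × (Fin m → ℝ) | p.2 ∈ slabSet a (c + d * p.1)} := by
  have h1 : IsClosed {p : ℝ × (Fin m → ℝ) | p.2 ∈ slabSet a (c + d * p.1)} := by
    unfold slabSet
    simp only [mem_ofPred_eq, mem_Icc]
    refine IsClosed.and ?_ ?_
    · simp only [ofPred_forall]
      refine isClosed_iInter fun i => IsClosed.and ?_ ?_
      · exact isClosed_le (by fun_prop) (by fun_prop)
      · exact isClosed_le (by fun_prop) (by fun_prop)
    · exact isClosed_le (by fun_prop) (by fun_prop)
  exact h1.measurableSet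

theorem slabSet_subset_Icc {m : ℕ} (a : Fin m → ℝ) (s : ℝ) :
    slabSet a s ⊆ Icc (fun _ => -1) (fun _ => 1) :=
  fun _ hy => ⟨fun i => (hy.1 i).1, fun i => (hy.1 i).2⟩

theorem volume_slabSet_lt_top {m : ℕ} (a : Fin m → ℝ) (s : ℝ) : volume (slabSet a s) < ⊤ :=
  (measure_mono (slabSet_subset_Icc a s)).trans_lt isCompact_Icc.measure_lt_top

theorem slabVolume_nonneg {m : ℕ} (a : Fin m → ℝ) (s : ℝ) : 0 ≤ slabVolume a s :=
  ENNReal.toReal_nonneg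

theorem slabVolume_le {m : ℕ} (a : Fin m → ℝ) (s : ℝ) :
    slabVolume a s ≤ (volume (Icc (fun _ => -1) (fun _ => 1) : Set (Fin m → ℝ))).toReal :=
  ENNReal.toReal_mono isCompact_Icc.measure_lt_top.ne (measure_mono (slabSet_subset_Icc a s))

theorem measurable_slabVolume {m : ℕ} (a : Fin m → ℝ) : Measurable (slabVolume a) := by
  have h := measurable_measure_prodMk_left (ν := (volume : Measure (Fin m → ℝ)))
    (measurableSet_slabSet_prod a 0 1)
  simp only [zero_add, one_mul] at h
  exact h.ennreal_toReal

theorem intervalIntegrable_slabVolume {m : ℕ} (a : Fin m → ℝ) (p q : ℝ) :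
    IntervalIntegrable (slabVolume a) volume p q := by
  refine (intervalIntegrable_const (c := (volume (Icc (fun _ => -1) (fun _ => 1) :
    Set (Fin m → ℝ))).toReal)).mono_fun' (measurable_slabVolume a).aestronglyMeasurable ?_
  refine Filter.Eventually.of_forall fun x => ?_
  exact (Real.norm_of_nonneg (slabVolume_nonneg a x)).trans_le (slabVolume_le a x)

/-- Freezing `y i = u` leaves a slab of one dimension less with offset `s + a i * u`; the offset `s`
exists so that this recursion closes. -/
theorem slabVolume_eq_integral {m : ℕ} (a : Fin (m + 1) → ℝ) (i : Fin (m + 1)) (s : ℝ) :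
    slabVolume a s = ∫ u in (-1 : ℝ)..1, slabVolume (i.removeNth a) (s + a i * u) := by
  have hT := measurableSet_slabSet_prod (i.removeNth a) s (a i)
  have hS : MeasurableSet (Prod.fst ⁻¹' Icc (-1 : ℝ) 1 ∩
      {p : ℝ × (Fin m → ℝ) | p.2 ∈ slabSet (i.removeNth a) (s + a i * p.1)}) :=
    (measurable_fst measurableSet_Icc).inter hT
  have hpre : slabSet a s = MeasurableEquiv.piFinSuccAbove (fun _ : Fin (m + 1) => ℝ) i ⁻¹'
      (Prod.fst ⁻¹' Icc (-1 : ℝ) 1 ∩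
        {p : ℝ × (Fin m → ℝ) | p.2 ∈ slabSet (i.removeNth a) (s + a i * p.1)}) := by
    ext y
    simp [slabSet, MeasurableEquiv.piFinSuccAbove, Fin.insertNthEquiv, i.forall_iff_succAbove,
      i.sum_univ_succAbove, Fin.removeNth, add_assoc, and_assoc]
  have hslice : ∀ u : ℝ, (volume (Prod.mk u ⁻¹' (Prod.fst ⁻¹' Icc (-1 : ℝ) 1 ∩
      {p : ℝ × (Fin m → ℝ) | p.2 ∈ slabSet (i.removeNth a) (s + a i * p.1)}))).toReal
      = (Icc (-1 : ℝ) 1).indicator (fun u => slabVolume (i.removeNth a) (s + a i * u)) u := by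
    intro u
    by_cases hu : u ∈ Icc (-1 : ℝ) 1
    · rw [indicator_of_mem hu, slabVolume]
      congr 2
      ext y
      simp [mem_Icc.1 hu]
    · rw [indicator_of_notMem hu]
      have : Prod.mk u ⁻¹' (Prod.fst ⁻¹' Icc (-1 : ℝ) 1 ∩
        {p : ℝ × (Fin m → ℝ) | p.2 ∈ slabSet (i.removeNth a) (s + a i * p.1)}) = ∅ := by
        ext y
        simp only [mem_preimage, mem_inter_iff, hu, false_and, mem_empty_iff_false]
      simp [this]
  rw [intervalIntegral.integral_of_le (by norm_num), ← integral_Icc_eq_integral_Ioc,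
    ← integral_indicator measurableSet_Icc, ← integral_congr_ae (Filter.Eventually.of_forall hslice),
    integral_toReal (measurable_measure_prodMk_left hS).aemeasurable, ← Measure.prod_apply hS,
    slabVolume, hpre,
    (volume_preserving_piFinSuccAbove (fun _ : Fin (m + 1) => ℝ) i).measure_preimage
      hS.nullMeasurableSet]
  · rfl
  · refine Filter.Eventually.of_forall fun u => ?_
    refine (measure_mono ?_).trans_lt (volume_slabSet_lt_top (i.removeNth a) (s + a i * u))
    exact fun y hy => hy.2

/-! ### Averages of symmetric unimodal functions -/

/-- A function on `ℝ` is symmetric unimodal if it is even and antitone in the absolute value. -/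
def SymmUnimodal (φ : ℝ → ℝ) : Prop := ∀ ⦃s t : ℝ⦄, |s| ≤ |t| → φ t ≤ φ s

theorem SymmUnimodal.neg {φ : ℝ → ℝ} (h : SymmUnimodal φ) (s : ℝ) : φ (-s) = φ s :=
  le_antisymm (h (by simp)) (h (by simp))

theorem integral_comp_add_abs_mul (φ : ℝ → ℝ) (s c : ℝ) :
    ∫ u in (-1 : ℝ)..1, φ (s + |c| * u) = ∫ u in (-1 : ℝ)..1, φ (s + c * u) := by
  rcases abs_choice c with h | h
  · rw [h]
  · rw [h]
    have := intervalIntegral.integral_comp_neg (a := -1) (b := 1) (fun u => φ (s + c * u))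
    simpa using this

/-- Both sides compare the integrals of `φ` over the windows `[s - c, s + c]` and `[t - c, t + c]`.
The right side reduces monotonicity of the averages to the sign of `φ (r - c) - φ (r + c)`. -/
theorem mul_integral_sub_integral {φ : ℝ → ℝ} (hi : ∀ p q, IntervalIntegrable φ volume p q)
    (c s t : ℝ) :
    c * ((∫ u in (-1 : ℝ)..1, φ (s + c * u)) - ∫ u in (-1 : ℝ)..1, φ (t + c * u))
      = ∫ r in s..t, (φ (r - c) - φ (r + c)) := by
  have hsub : IntervalIntegrable (fun r => φ (r - c)) volume s t := by
    simpa using (hi (s - c) (t - c)).comp_sub_right c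
  have hadd : IntervalIntegrable (fun r => φ (r + c)) volume s t := by
    simpa using (hi (s + c) (t + c)).comp_add_right c
  rw [mul_sub, intervalIntegral.mul_integral_comp_add_mul,
    intervalIntegral.mul_integral_comp_add_mul, intervalIntegral.integral_sub hsub hadd,
    intervalIntegral.integral_comp_sub_right, intervalIntegral.integral_comp_add_right,
    intervalIntegral.integral_interval_sub_interval_comm (hi _ _) (hi _ _) (hi _ _)]
  simp only [mul_one, mul_neg, sub_eq_add_neg]

theorem integral_comp_even {φ : ℝ → ℝ} (h : SymmUnimodal φ) (c s : ℝ) :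
    ∫ u in (-1 : ℝ)..1, φ (|s| + c * u) = ∫ u in (-1 : ℝ)..1, φ (s + c * u) := by
  rcases abs_choice s with hs | hs
  · rw [hs]
  · rw [hs]
    have := intervalIntegral.integral_comp_neg (a := -1) (b := 1) (fun u => φ (-s + c * u))
    rw [neg_neg] at this
    rw [← this]
    refine intervalIntegral.integral_congr fun u _ => ?_
    rw [← h.neg]
    congr 1
    ring

theorem SymmUnimodal.integral {φ : ℝ → ℝ} (h : SymmUnimodal φ)
    (hi : ∀ p q, IntervalIntegrable φ volume p q) (c : ℝ) :
    SymmUnimodal (fun s => ∫ u in (-1 : ℝ)..1, φ (s + c * u)) := by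
  intro s t hst
  change ∫ u in (-1 : ℝ)..1, φ (t + c * u) ≤ ∫ u in (-1 : ℝ)..1, φ (s + c * u)
  rcases eq_or_ne c 0 with rfl | hc
  · simpa using h hst
  have hc' : 0 < |c| := abs_pos.2 hc
  rw [← integral_comp_even h c t, ← integral_comp_even h c s, ← integral_comp_add_abs_mul,
    ← integral_comp_add_abs_mul φ |s|]
  have key := mul_integral_sub_integral hi |c| |s| |t|
  have hnn : 0 ≤ ∫ r in |s|..|t|, (φ (r - |c|) - φ (r + |c|)) := by
    refine intervalIntegral.integral_nonneg hst fun r hr => sub_nonneg.2 (h ?_)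
    have hr0 : 0 ≤ r := (abs_nonneg s).trans hr.1
    rw [abs_of_nonneg (by positivity : 0 ≤ r + |c|)]
    exact abs_le.2 ⟨by linarith, by linarith⟩
  rw [← key] at hnn
  linarith [nonneg_of_mul_nonneg_right hnn hc']

theorem SymmUnimodal.integral_lt {φ : ℝ → ℝ} (h : SymmUnimodal φ)
    (hi : ∀ p q, IntervalIntegrable φ volume p q)
    (hφ : ∀ r ∈ Ioo (0 : ℝ) 1, φ (r + 1) < φ (r - 1)) {s t : ℝ} (hs : |s| < 1) (hst : |s| < |t|) :
    ∫ u in (-1 : ℝ)..1, φ (t + 1 * u) < ∫ u in (-1 : ℝ)..1, φ (s + 1 * u) := by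
  -- The strict hypothesis covers only `r < 1`, so the shift stops at `min |t| 1`; weak monotonicity
  -- covers the rest.
  have key := mul_integral_sub_integral hi 1 |s| (min |t| 1)
  have hlt : |s| < min |t| 1 := lt_min hst hs
  have hpos : 0 < ∫ r in |s|..(min |t| 1), (φ (r - 1) - φ (r + 1)) := by
    refine intervalIntegral.intervalIntegral_pos_of_pos_on ?_ (fun r hr => ?_) hlt
    · refine IntervalIntegrable.sub ?_ ?_
      · simpa using (hi (|s| - 1) (min |t| 1 - 1)).comp_sub_right 1
      · simpa using (hi (|s| + 1) (min |t| 1 + 1)).comp_add_right 1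
    · exact sub_pos.2 (hφ r ⟨(abs_nonneg s).trans_lt hr.1, hr.2.trans_le (min_le_right _ _)⟩)
  rw [← key, integral_comp_even h 1 s] at hpos
  have hmono := h.integral hi 1 (s := min |t| 1) (t := t)
    (by rw [abs_of_nonneg (by positivity)]; exact min_le_left _ _)
  simp only at hmono
  linarith

/-! ### Monotonicity of slab volumes in the coefficients -/

theorem slabVolume_zero_eq (a : Fin 0 → ℝ) (s : ℝ) :
    slabVolume a s = (Icc (-1 : ℝ) 1).indicator 1 s := by
  by_cases hs : s ∈ Icc (-1 : ℝ) 1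
  · have : slabSet a s = univ := by ext y; simpa [slabSet, abs_le] using hs
    rw [indicator_of_mem hs, slabVolume, this]
    simp [volume_pi]
  · have : slabSet a s = ∅ := by ext y; simpa [slabSet, abs_le] using hs
    rw [indicator_of_notMem hs, slabVolume, this]
    simp

theorem symmUnimodal_slabVolume {m : ℕ} (a : Fin m → ℝ) : SymmUnimodal (slabVolume a) := by
  induction m with
  | zero =>
    intro s t hst
    rw [slabVolume_zero_eq, slabVolume_zero_eq]
    by_cases ht : t ∈ Icc (-1 : ℝ) 1
    · have hs : s ∈ Icc (-1 : ℝ) 1 := abs_le.1 (hst.trans (abs_le.2 ht))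
      rw [indicator_of_mem ht, indicator_of_mem hs]
      rfl
    · rw [indicator_of_notMem ht]
      exact indicator_nonneg (fun _ _ => zero_le_one) s
  | succ m ih =>
    have := (ih (Fin.removeNth 0 a)).integral (intervalIntegrable_slabVolume _) (a 0)
    rwa [← funext (slabVolume_eq_integral a 0)] at this

theorem intervalIntegrable_slabVolume_mul {m : ℕ} (a : Fin m → ℝ) (c p q : ℝ) :
    IntervalIntegrable (fun u => slabVolume a (c * u)) volume p q := by
  refine (intervalIntegrable_const (c := (volume (Icc (fun _ => -1) (fun _ => 1) :
    Set (Fin m → ℝ))).toReal)).mono_fun'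
    ((measurable_slabVolume a).comp (measurable_const_mul c)).aestronglyMeasurable ?_
  refine Filter.Eventually.of_forall fun x => ?_
  exact (Real.norm_of_nonneg (slabVolume_nonneg a _)).trans_le (slabVolume_le a _)

theorem slabVolume_update_le {m : ℕ} (a : Fin m → ℝ) (i : Fin m) {c : ℝ} (hc : |a i| ≤ |c|) :
    slabVolume (Function.update a i c) 0 ≤ slabVolume a 0 := by
  cases m with
  | zero => exact i.elim0
  | succ m =>
    rw [slabVolume_eq_integral _ i, slabVolume_eq_integral a i]
    simp only [Fin.removeNth_update, Function.update_self, zero_add]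
    refine intervalIntegral.integral_mono_on (by norm_num)
      (intervalIntegrable_slabVolume_mul _ _ _ _) (intervalIntegrable_slabVolume_mul _ _ _ _)
      fun u _ => symmUnimodal_slabVolume _ ?_
    rw [abs_mul, abs_mul]
    gcongr

theorem slabVolume_anti {m : ℕ} {a b : Fin m → ℝ} (h : ∀ i, |a i| ≤ |b i|) :
    slabVolume b 0 ≤ slabVolume a 0 := by
  classical
  -- The coefficients are exchanged one at a time, with `S` the set already exchanged.
  have key : ∀ S : Finset (Fin m), slabVolume (S.piecewise b a) 0 ≤ slabVolume a 0 := by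
    intro S
    induction S using Finset.induction_on with
    | empty => simp
    | insert i S hi ih =>
      rw [Finset.piecewise_insert]
      refine (slabVolume_update_le _ i ?_).trans ih
      rw [Finset.piecewise_eq_of_notMem _ _ _ hi]
      exact h i
  simpa using key Finset.univ

/-- Strictness passes up the dimensions: for `0 < r < 1`, the point `r - 1` has modulus `1 - r`,
below both `1` and `r + 1`. It starts from the jump of the indicator at `1`. One coordinate is the
least possible, since the indicator itself is constant on `[-1,1]`. -/
theorem slabVolume_one_lt {m : ℕ} {s t : ℝ} (hs : |s| < 1) (hst : |s| < |t|) :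
    slabVolume (1 : Fin (m + 1) → ℝ) t < slabVolume (1 : Fin (m + 1) → ℝ) s := by
  have step : ∀ (k : ℕ), (∀ r ∈ Ioo (0 : ℝ) 1, slabVolume (1 : Fin k → ℝ) (r + 1)
      < slabVolume (1 : Fin k → ℝ) (r - 1)) → ∀ {s t : ℝ}, |s| < 1 → |s| < |t| →
      slabVolume (1 : Fin (k + 1) → ℝ) t < slabVolume (1 : Fin (k + 1) → ℝ) s := by
    intro k hk s t hs hst
    rw [slabVolume_eq_integral _ 0, slabVolume_eq_integral _ 0]
    exact (symmUnimodal_slabVolume _).integral_lt (intervalIntegrable_slabVolume _) hk hs hst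
  induction m generalizing s t with
  | zero =>
    refine step 0 (fun r hr => ?_) hs hst
    rw [slabVolume_zero_eq, slabVolume_zero_eq,
      indicator_of_notMem (fun h => by linarith [h.2, hr.1]),
      indicator_of_mem (mem_Icc.2 ⟨by linarith [hr.1], by linarith [hr.2]⟩)]
    exact one_pos
  | succ m ih =>
    refine step (m + 1) (fun r hr => ih ?_ ?_) hs hst
    · rw [abs_of_nonpos (by linarith [hr.2])]; linarith [hr.1]
    · rw [abs_of_nonpos (by linarith [hr.2] : r - 1 ≤ 0), abs_of_pos (by linarith [hr.1])]
      linarith [hr.1]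

theorem slabVolume_one_lt_update {m : ℕ} (i : Fin (m + 2)) {c : ℝ} (hc : |c| < 1) :
    slabVolume (1 : Fin (m + 2) → ℝ) 0 < slabVolume (Function.update 1 i c) 0 := by
  rw [slabVolume_eq_integral _ i, slabVolume_eq_integral (Function.update 1 i c) i]
  simp only [Fin.removeNth_update, Function.update_self, zero_add, Pi.one_apply]
  have hone : i.removeNth (1 : Fin (m + 2) → ℝ) = 1 := rfl
  rw [hone, ← sub_pos, ← intervalIntegral.integral_sub
    (intervalIntegrable_slabVolume_mul _ _ _ _) (intervalIntegrable_slabVolume_mul _ _ _ _)]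
  have hint : ∀ p q, IntervalIntegrable (fun u => slabVolume (1 : Fin (m + 1) → ℝ) (c * u) -
      slabVolume (1 : Fin (m + 1) → ℝ) (1 * u)) volume p q := fun p q =>
    (intervalIntegrable_slabVolume_mul _ _ _ _).sub (intervalIntegrable_slabVolume_mul _ _ _ _)
  have hpos : ∀ u : ℝ, u ≠ 0 → |u| < 1 → 0 < slabVolume (1 : Fin (m + 1) → ℝ) (c * u) -
      slabVolume (1 : Fin (m + 1) → ℝ) (1 * u) := by
    intro u hu hu1
    have h1 : |c * u| < |u| := by
      rw [abs_mul]
      exact mul_lt_of_lt_one_left (abs_pos.2 hu) hc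
    rw [one_mul]
    exact sub_pos.2 (slabVolume_one_lt (h1.trans hu1) h1)
  -- The integrand vanishes at `u = 0`, so positivity is applied on each side separately.
  rw [← intervalIntegral.integral_add_adjacent_intervals (hint (-1) 0) (hint 0 1)]
  refine add_pos ?_ ?_
  · exact intervalIntegral.intervalIntegral_pos_of_pos_on (hint _ _)
      (fun u hu => hpos u hu.2.ne (abs_lt.2 ⟨hu.1, by linarith [hu.2]⟩)) (by norm_num)
  · exact intervalIntegral.intervalIntegral_pos_of_pos_on (hint _ _)
      (fun u hu => hpos u hu.1.ne' (abs_lt.2 ⟨by linarith [hu.1], hu.2⟩)) (by norm_num)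

theorem slabVolume_pos {m : ℕ} (a : Fin m → ℝ) : 0 < slabVolume a 0 := by
  refine ENNReal.toReal_pos ?_ (volume_slabSet_lt_top a 0).ne
  have hopen : IsOpen {y : Fin m → ℝ | (∀ i, -1 < y i ∧ y i < 1) ∧ |0 + ∑ i, a i * y i| < 1} := by
    refine IsOpen.and ?_ (isOpen_lt (by fun_prop) (by fun_prop))
    simp only [ofPred_forall]
    exact isOpen_iInter_of_finite fun i =>
      (isOpen_lt (by fun_prop) (by fun_prop)).and (isOpen_lt (by fun_prop) (by fun_prop))
  refine ((hopen.measure_pos volume ⟨0, by simp⟩).trans_le (measure_mono ?_)).ne'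
  exact fun y hy => ⟨fun i => ⟨(hy.1 i).1.le, (hy.1 i).2.le⟩, hy.2.le⟩

/-! ### Central sections of the cube as graphs over slabs -/

/-- The linear parametrization of the hyperplane `x^⊥` by the coordinates other than the `j`-th,
for a vector `x` with `|x j| = 1`. -/
noncomputable def hyperplaneParam {m : ℕ} (x : EuclideanSpace ℝ (Fin (m + 1))) (j : Fin (m + 1)) :
    EuclideanSpace ℝ (Fin m) →ₗ[ℝ] EuclideanSpace ℝ (Fin (m + 1)) where
  toFun y := WithLp.toLp 2 (j.insertNth (-(x j * ∑ i, x (j.succAbove i) * y i)) (fun i => y i))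
  map_add' y z := by
    ext k
    refine Fin.succAboveCases j ?_ (fun i => ?_) k
    · simp [mul_add, Finset.sum_add_distrib]; ring
    · simp
  map_smul' c y := by
    ext k
    refine Fin.succAboveCases j ?_ (fun i => ?_) k
    · simp [Finset.mul_sum, mul_left_comm]
    · simp

theorem hyperplaneParam_apply_self {m : ℕ} (x : EuclideanSpace ℝ (Fin (m + 1))) (j : Fin (m + 1))
    (y : EuclideanSpace ℝ (Fin m)) :
    hyperplaneParam x j y j = -(x j * ∑ i, x (j.succAbove i) * y i) := by
  simp [hyperplaneParam]

theorem hyperplaneParam_apply_succAbove {m : ℕ} (x : EuclideanSpace ℝ (Fin (m + 1)))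
    (j : Fin (m + 1)) (y : EuclideanSpace ℝ (Fin m)) (i : Fin m) :
    hyperplaneParam x j y (j.succAbove i) = y i := by
  simp [hyperplaneParam]

/-- The Gram matrix of the image basis is `1 + w wᵀ`, where `w` is `x` without its `j`-th entry. Its
determinant is `1 + |w|² = |x|²`, because `(x j)² = 1`. -/
theorem normDet_hyperplaneParam {m : ℕ} (x : EuclideanSpace ℝ (Fin (m + 1))) (j : Fin (m + 1))
    (hj : |x j| = 1) : (hyperplaneParam x j).normDet = ‖x‖ := by
  have hjj : x j * x j = 1 := by rw [← abs_mul_abs_self, hj, one_mul]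
  have h := (hyperplaneParam x j).normDet_sq_eq_det_gram (EuclideanSpace.basisFun (Fin m) ℝ)
  have hsum : ∀ i : Fin m, ∑ k, x (j.succAbove k) * (EuclideanSpace.basisFun (Fin m) ℝ i) k
      = x (j.succAbove i) := by
    intro i
    simp [EuclideanSpace.basisFun_apply]
  have hgram : Matrix.gram ℝ (fun i => hyperplaneParam x j (EuclideanSpace.basisFun (Fin m) ℝ i))
      = 1 + Matrix.replicateCol Unit (fun i => x (j.succAbove i)) *
          Matrix.replicateRow Unit (fun i => x (j.succAbove i)) := by
    ext i k
    rw [Matrix.gram_apply, PiLp.inner_apply, j.sum_univ_succAbove]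
    simp only [hyperplaneParam_apply_self, hyperplaneParam_apply_succAbove, hsum]
    have h1 : ∑ l, inner ℝ ((EuclideanSpace.basisFun (Fin m) ℝ i) l)
        ((EuclideanSpace.basisFun (Fin m) ℝ k) l) = (1 : Matrix (Fin m) (Fin m) ℝ) i k := by
      rw [← PiLp.inner_apply, Matrix.one_apply]
      exact orthonormal_iff_ite.1 (EuclideanSpace.basisFun (Fin m) ℝ).orthonormal i k
    rw [h1, Matrix.add_apply, Matrix.mul_apply]
    simp only [RCLike.inner_apply, conj_trivial, Matrix.replicateCol_apply,
      Matrix.replicateRow_apply, Finset.univ_unique, Finset.sum_singleton]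
    linear_combination (x (j.succAbove i) * x (j.succAbove k)) * hjj
  rw [hgram, Matrix.det_one_add_replicateCol_mul_replicateRow] at h
  have hx : ‖x‖ ^ 2 = 1 + (fun i => x (j.succAbove i)) ⬝ᵥ (fun i => x (j.succAbove i)) := by
    rw [EuclideanSpace.norm_sq_eq, j.sum_univ_succAbove]
    simp [dotProduct, hj, ← sq]
  rw [← hx] at h
  exact (sq_eq_sq₀ (LinearMap.normDet_nonneg _) (norm_nonneg x)).1 (by simpa using h)

theorem image_hyperplaneParam {m : ℕ} (x : EuclideanSpace ℝ (Fin (m + 1))) (j : Fin (m + 1))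
    (hj : |x j| = 1) :
    hyperplaneParam x j '' (WithLp.ofLp ⁻¹' slabSet (fun i => x (j.succAbove i)) 0) =
      ((Submodule.span ℝ {x})ᗮ : Set (EuclideanSpace ℝ (Fin (m + 1)))) ∩ cube (m + 1) := by
  have hjj : x j * x j = 1 := by rw [← abs_mul_abs_self, hj, one_mul]
  ext z
  simp only [mem_image, mem_preimage, mem_inter_iff, SetLike.mem_coe,
    Submodule.mem_orthogonal_singleton_iff_inner_right, PiLp.inner_apply, RCLike.inner_apply,
    conj_trivial, j.sum_univ_succAbove, cube, slabSet, mem_ofPred_eq, zero_add]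
  constructor
  · rintro ⟨y, ⟨hy, hs⟩, rfl⟩
    simp only [j.forall_iff_succAbove, hyperplaneParam_apply_self, hyperplaneParam_apply_succAbove]
    refine ⟨?_, ?_, hy⟩
    · simp only [mul_comm (y _)]
      linear_combination (-∑ i, x (j.succAbove i) * y i) * hjj
    · refine abs_le.1 ?_
      rwa [abs_neg, abs_mul, hj, one_mul]
  · rintro ⟨hz, hc⟩
    have hzj : z j = -(x j * ∑ i, x (j.succAbove i) * z (j.succAbove i)) := by
      simp only [mul_comm (z _)] at hz
      linear_combination (x j) * hz - z j * hjj
    refine ⟨WithLp.toLp 2 (fun i => z (j.succAbove i)), ⟨fun i => hc _, ?_⟩, ?_⟩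
    · have := abs_le.2 (hc j)
      rwa [hzj, abs_neg, abs_mul, hj, one_mul] at this
    · ext k
      refine Fin.succAboveCases j ?_ (fun i => ?_) k
      · rw [hyperplaneParam_apply_self, hzj]
      · rw [hyperplaneParam_apply_succAbove]

theorem sectionVolume_cube {m : ℕ} (x : EuclideanSpace ℝ (Fin (m + 1))) (j : Fin (m + 1))
    (hj : |x j| = 1) : sectionVolume (cube (m + 1)) x =
      ENNReal.ofReal ‖x‖ * volume (slabSet (fun i => x (j.succAbove i)) 0) := by
  have h := (hyperplaneParam x j).euclideanHausdorffMeasure_image_eq_normDet_mul_volume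
    (WithLp.ofLp ⁻¹' slabSet (fun i => x (j.succAbove i)) 0)
  have hS : MeasurableSet (slabSet (fun i => x (j.succAbove i)) 0) := by
    have := measurableSet_slabSet_prod (fun i => x (j.succAbove i)) 0 0
    simp only [zero_mul, zero_add] at this
    exact measurable_prodMk_left (x := (0 : ℝ)) this
  rw [image_hyperplaneParam x j hj, normDet_hyperplaneParam x j hj, finrank_euclideanSpace_fin,
    (PiLp.volume_preserving_ofLp (Fin m)).measure_preimage hS.nullMeasurableSet] at h
  exact h

theorem distanceFunction_intersectionBody_cube {m : ℕ} (x : EuclideanSpace ℝ (Fin (m + 1)))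
    (j : Fin (m + 1)) (hj : |x j| = 1) :
    distanceFunction (intersectionBody (cube (m + 1))) x =
      (slabVolume (fun i => x (j.succAbove i)) 0)⁻¹ := by
  have hx : 0 < ‖x‖ := norm_pos_iff.2 fun h => by simp [h] at hj
  have hpos := ENNReal.toReal_pos_iff.1 (slabVolume_pos fun i => x (j.succAbove i))
  have hsec := sectionVolume_cube x j hj
  rw [distanceFunction_intersectionBody, hsec, ENNReal.toReal_mul,
    ENNReal.toReal_ofReal hx.le, ← slabVolume]
  · field_simp
  · rw [hsec]
    exact mul_ne_zero (ENNReal.ofReal_pos.2 hx).ne' hpos.1.ne'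
  · rw [hsec]
    exact ENNReal.mul_ne_top ENNReal.ofReal_ne_top hpos.2.ne

/-! ### Fourier inversion and the sinc integral -/

open scoped FourierTransform Convolution

/-- The indicator function of `[-1,1]`, as a complex valued function. -/
noncomputable def intervalIndicator : ℝ → ℂ := (Icc (-1 : ℝ) 1).indicator 1

theorem integrable_intervalIndicator : Integrable intervalIndicator :=
  (integrable_indicator_iff measurableSet_Icc).2 (integrableOn_const (by simp))

theorem fourier_intervalIndicator (ξ : ℝ) :
    𝓕 intervalIndicator ξ = ((2 * Real.sinc (2 * Real.pi * ξ) : ℝ) : ℂ) := by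
  have h : 𝓕 intervalIndicator ξ
      = ∫ x in (-1 : ℝ)..1, Complex.exp ((-(2 * Real.pi * ξ) * Complex.I) * x) := by
    rw [Real.fourier_eq', intervalIntegral.integral_of_le (by norm_num),
      ← integral_Icc_eq_integral_Ioc, ← integral_indicator measurableSet_Icc]
    refine integral_congr_ae (Filter.Eventually.of_forall fun x => ?_)
    by_cases hx : x ∈ Icc (-1 : ℝ) 1
    · simp only [intervalIndicator, indicator_of_mem hx, Pi.one_apply, smul_eq_mul, mul_one]
      congr 1
      simp
      ring
    · simp only [intervalIndicator, indicator_of_notMem hx, smul_zero]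
  rw [h]
  rcases eq_or_ne ξ 0 with rfl | hξ
  · simp; norm_num
  have hξ' : 2 * Real.pi * ξ ≠ 0 := mul_ne_zero (by positivity) hξ
  have hc : (2 * Real.pi * ξ : ℂ) ≠ 0 := by exact_mod_cast hξ'
  rw [integral_exp_mul_complex (mul_ne_zero (neg_ne_zero.2 hc) Complex.I_ne_zero),
    Real.sinc_of_ne_zero hξ']
  push_cast
  rw [Complex.sin]
  field_simp
  rw [Complex.I_sq]
  ring_nf

theorem slabVolume_one_succ_eq_convolution (m : ℕ) :
    (fun s => (slabVolume (1 : Fin (m + 1) → ℝ) s : ℂ)) =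
      intervalIndicator ⋆[ContinuousLinearMap.mul ℂ ℂ]
        (fun s => (slabVolume (1 : Fin m → ℝ) s : ℂ)) := by
  ext s
  have h1 : slabVolume (1 : Fin (m + 1) → ℝ) s
      = ∫ u in (-1 : ℝ)..1, slabVolume (1 : Fin m → ℝ) (s - u) := by
    have := intervalIntegral.integral_comp_neg (a := -1) (b := 1)
      (fun u => slabVolume (1 : Fin m → ℝ) (s - u))
    rw [neg_neg] at this
    rw [slabVolume_eq_integral _ 0, ← this]
    refine intervalIntegral.integral_congr fun u _ => ?_
    simp only [Pi.one_apply, one_mul, sub_neg_eq_add]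
    rfl
  rw [convolution_def, h1, ← intervalIntegral.integral_ofReal,
    intervalIntegral.integral_of_le (by norm_num), ← integral_Icc_eq_integral_Ioc,
    ← integral_indicator measurableSet_Icc]
  refine integral_congr_ae (Filter.Eventually.of_forall fun u => ?_)
  by_cases hu : u ∈ Icc (-1 : ℝ) 1
  · simp [intervalIndicator, indicator_of_mem hu]
  · simp [intervalIndicator, indicator_of_notMem hu]

theorem slabVolume_zero_eq_intervalIndicator :
    (fun s => (slabVolume (1 : Fin 0 → ℝ) s : ℂ)) = intervalIndicator := by
  ext s
  rw [slabVolume_zero_eq]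
  by_cases hs : s ∈ Icc (-1 : ℝ) 1
  · simp [intervalIndicator, indicator_of_mem hs]
  · simp [intervalIndicator, indicator_of_notMem hs]

theorem integrable_slabVolume_one (m : ℕ) :
    Integrable (fun s => (slabVolume (1 : Fin m → ℝ) s : ℂ)) := by
  induction m with
  | zero =>
    rw [slabVolume_zero_eq_intervalIndicator]
    exact integrable_intervalIndicator
  | succ m ih =>
    rw [slabVolume_one_succ_eq_convolution]
    exact integrable_intervalIndicator.integrable_convolution _ ih

theorem fourier_slabVolume_one (m : ℕ) (ξ : ℝ) :
    𝓕 (fun s => (slabVolume (1 : Fin m → ℝ) s : ℂ)) ξ =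
      (((2 * Real.sinc (2 * Real.pi * ξ)) ^ (m + 1) : ℝ) : ℂ) := by
  induction m with
  | zero => rw [slabVolume_zero_eq_intervalIndicator, fourier_intervalIndicator, zero_add, pow_one]
  | succ m ih =>
    rw [slabVolume_one_succ_eq_convolution, Real.fourier_mul_convolution_eq
      integrable_intervalIndicator (integrable_slabVolume_one m), ih, fourier_intervalIndicator,
      ← Complex.ofReal_mul, ← pow_succ']

/-- Pointwise Fourier inversion at `0` needs continuity there; a window integral is a difference of
two continuous primitives. -/
theorem continuous_slabVolume_one (m : ℕ) : Continuous (slabVolume (1 : Fin (m + 1) → ℝ)) := by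
  have h : slabVolume (1 : Fin (m + 1) → ℝ) = fun s =>
      (∫ u in (0 : ℝ)..(s + 1), slabVolume (1 : Fin m → ℝ) u) -
        ∫ u in (0 : ℝ)..(s - 1), slabVolume (1 : Fin m → ℝ) u := by
    ext s
    have hi := intervalIntegrable_slabVolume (1 : Fin m → ℝ)
    have := intervalIntegral.integral_comp_add_left (a := -1) (b := 1)
      (slabVolume (1 : Fin m → ℝ)) s
    rw [intervalIntegral.integral_interval_sub_left (hi _ _) (hi _ _), sub_eq_add_neg s 1, ← this,
      slabVolume_eq_integral _ 0]
    simp only [Pi.one_apply, one_mul]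
    rfl
  rw [h]
  have hc := intervalIntegral.continuous_primitive
    (intervalIntegrable_slabVolume (1 : Fin m → ℝ)) 0
  exact (hc.comp (continuous_add_const 1)).sub (hc.comp (continuous_sub_right 1))

theorem integrable_sinc_pow {n : ℕ} (hn : 2 ≤ n) : Integrable (fun t => Real.sinc t ^ n) := by
  -- The constant `2` adds the bounds `sinc² ≤ 1` and `t² sinc² ≤ 1`.
  refine (integrable_inv_one_add_sq.const_mul 2).mono'
    (Real.continuous_sinc.pow n).aestronglyMeasurable (Filter.Eventually.of_forall fun t => ?_)
  have h1 : ‖Real.sinc t ^ n‖ ≤ Real.sinc t ^ 2 := by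
    rw [norm_pow, Real.norm_eq_abs, ← sq_abs]
    exact pow_le_pow_of_le_one (abs_nonneg _) (Real.abs_sinc_le_one t) hn
  refine h1.trans ?_
  rw [← div_eq_mul_inv, le_div_iff₀ (by positivity), mul_add, mul_one]
  have h2 : Real.sinc t ^ 2 ≤ 1 := (sq_le_one_iff_abs_le_one _).2 (Real.abs_sinc_le_one t)
  have h3 : Real.sinc t ^ 2 * t ^ 2 ≤ 1 := by
    rcases eq_or_ne t 0 with rfl | ht
    · simp
    · rw [Real.sinc_of_ne_zero ht, ← mul_pow, div_mul_cancel₀ _ ht]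
      exact Real.sin_sq_le_one t
  linarith

theorem integral_sinc_pow (n : ℕ) :
    ∫ t, Real.sinc t ^ n = Real.pi * sigma n := by
  have h1 : ∀ t, Real.sinc t ^ n = Real.sinc |t| ^ n := by
    intro t
    rcases abs_choice t with h | h <;> rw [h]
    rw [Real.sinc_neg]
  rw [integral_congr_ae (Filter.Eventually.of_forall h1),
    integral_comp_abs (f := fun t => Real.sinc t ^ n), sigma,
    setIntegral_congr_fun (g := fun t => (Real.sin t / t) ^ n) measurableSet_Ioi
      fun t ht => by simp only [Real.sinc_of_ne_zero (mem_Ioi.1 ht).ne']]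
  field_simp

theorem slabVolume_one_eq_sigma (m : ℕ) :
    slabVolume (1 : Fin (m + 1) → ℝ) 0 = sigma (m + 2) * 2 ^ (m + 1) := by
  have hpi : (2 * Real.pi) ≠ 0 := by positivity
  have hint : Integrable (fun ξ => (2 * Real.sinc (2 * Real.pi * ξ)) ^ (m + 2)) := by
    simp only [mul_pow]
    exact ((integrable_sinc_pow (by omega : 2 ≤ m + 2)).comp_mul_left' hpi).const_mul _
  have hF : 𝓕 (fun s => (slabVolume (1 : Fin (m + 1) → ℝ) s : ℂ)) =
      fun ξ => (((2 * Real.sinc (2 * Real.pi * ξ)) ^ (m + 2) : ℝ) : ℂ) :=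
    funext (fourier_slabVolume_one (m + 1))
  have hinv := (integrable_slabVolume_one (m + 1)).fourierInv_fourier_eq (v := 0)
    (by rw [hF]; exact hint.ofReal)
    (Complex.continuous_ofReal.comp (continuous_slabVolume_one m)).continuousAt
  rw [hF, Real.fourierInv_eq'] at hinv
  simp only [inner_zero_right, mul_zero, Complex.ofReal_zero, zero_mul, Complex.exp_zero,
    one_smul] at hinv
  rw [← Complex.ofReal_inj.1 (integral_complex_ofReal.symm.trans hinv)]
  simp only [mul_pow]
  -- Rescaling by `2π` gives `2 ^ (m + 2) * (2π)⁻¹ * π * sigma (m + 2)`.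
  rw [integral_const_mul, Measure.integral_comp_mul_left (fun t => Real.sinc t ^ (m + 2)),
    integral_sinc_pow, smul_eq_mul, abs_of_pos (by positivity)]
  field_simp
  ring

/-! ### Vertices of the cube and the conclusion -/

theorem mem_extremePoints_cube {n : ℕ} {x : EuclideanSpace ℝ (Fin n)} (hx : ∀ i, |x i| = 1) :
    x ∈ (cube n).extremePoints ℝ := by
  refine ⟨fun i => abs_le.1 (hx i).le, ?_⟩
  rintro y hy z hz ⟨a, b, ha, hb, hab, rfl⟩
  ext i
  have hy' := hy i
  have hz' := hz i
  have h := hx i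
  simp only [PiLp.add_apply, PiLp.smul_apply, smul_eq_mul, mem_Icc] at *
  obtain rfl : b = 1 - a := by linarith
  rcases (abs_eq zero_le_one).1 h with h | h <;> nlinarith

theorem exists_abs_eq_maxNorm {m : ℕ} (x : EuclideanSpace ℝ (Fin (m + 1))) :
    ∃ j, |x j| = maxNorm x := by
  obtain ⟨j, -, hj⟩ := Finset.exists_max_image Finset.univ (fun j => |x j|) Finset.univ_nonempty
  refine ⟨j, le_antisymm (norm_le_pi_norm (WithLp.ofLp x) j) ?_⟩
  exact (pi_norm_le_iff_of_nonneg (abs_nonneg _)).2 fun i => hj i (Finset.mem_univ i)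

theorem lemma2 (n : ℕ) (hn : 2 ≤ n) :
    distanceFunction (intersectionBody (cube n)) (onesVector n)
        = 1 / (sigma n * 2 ^ (n - 1)) ∧
      ∀ x : EuclideanSpace ℝ (Fin n), x ≠ 0 →
        distanceFunction (intersectionBody (cube n)) ((maxNorm x)⁻¹ • x)
            ≤ distanceFunction (intersectionBody (cube n)) (onesVector n) ∧
          (distanceFunction (intersectionBody (cube n)) ((maxNorm x)⁻¹ • x)
              = distanceFunction (intersectionBody (cube n)) (onesVector n) →
            n = 2 ∨ (maxNorm x)⁻¹ • x ∈ (cube n).extremePoints ℝ) := by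
  obtain ⟨m, rfl⟩ := Nat.exists_eq_add_of_le' hn
  have hones : distanceFunction (intersectionBody (cube (m + 2))) (onesVector (m + 2)) =
      (slabVolume (1 : Fin (m + 1) → ℝ) 0)⁻¹ :=
    distanceFunction_intersectionBody_cube (onesVector (m + 2)) 0 (by simp [onesVector])
  refine ⟨by rw [hones, slabVolume_one_eq_sigma, one_div]; rfl, fun x hx => ?_⟩
  obtain ⟨j, hj⟩ := exists_abs_eq_maxNorm x
  have hmax : 0 < maxNorm x := norm_pos_iff.2 fun h => hx (WithLp.ofLp_injective 2 h)
  have habs : ∀ i, |((maxNorm x)⁻¹ • x) i| = (maxNorm x)⁻¹ * |x i| := fun i => by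
    rw [PiLp.smul_apply, smul_eq_mul, abs_mul, abs_of_pos (inv_pos.2 hmax)]
  have hle : ∀ i, |((maxNorm x)⁻¹ • x) i| ≤ 1 := fun i => by
    rw [habs, inv_mul_le_iff₀ hmax, mul_one]
    exact norm_le_pi_norm (WithLp.ofLp x) i
  have hone : |((maxNorm x)⁻¹ • x) j| = 1 := by rw [habs, hj, inv_mul_cancel₀ hmax.ne']
  generalize (maxNorm x)⁻¹ • x = y at hle hone
  rw [hones, distanceFunction_intersectionBody_cube y j hone]
  refine ⟨inv_anti₀ (slabVolume_pos _) (slabVolume_anti fun i => by simpa using hle _),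
    fun heq => ?_⟩
  rw [inv_inj] at heq
  by_contra! hcon
  -- Excluding `n = 2` leaves at least two slab coordinates, as strictness requires.
  obtain ⟨k, rfl⟩ : ∃ k, m = k + 1 := Nat.exists_eq_succ_of_ne_zero (by omega)
  refine hcon.2 (mem_extremePoints_cube fun i => (hle i).antisymm ?_)
  by_contra! hi
  obtain ⟨l, rfl⟩ := Fin.exists_succAbove_eq (x := i) (y := j) (by rintro rfl; exact hi.ne hone)
  -- Raising every coefficient except the `l`-th to `1` does not increase the volume, yet the result
  -- still strictly exceeds the value at `1`.
  refine (slabVolume_one_lt_update l hi).not_ge (le_of_le_of_eq (slabVolume_anti fun i => ?_) heq)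
  rcases eq_or_ne i l with rfl | hil
  · simp
  · simpa [Function.update_of_ne hil] using hle _
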